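/- Let $B_0,W\in\mathbb{R}^{N\times N}$ with $B_0$ symmetric and $W$ symmetric positive definite, and let $S\in\mathbb{R}^{N\times M}$ with $\operatorname{rk}(S)=M$. For $A\in\mathbb{R}^{N\times N}$ let $A⊛A=\Gamma(A\otimes A)\Gamma^\top$ be the symmetric Kronecker product, where $\Gamma$ maps the vector of elements of a matrix $K$ to that of $\tfrac12(K+K^\top)$; thus $(A⊛A)_{ij,k\ell}=\tfrac12(A_{ik}A_{j\ell}+A_{jk}A_{i\ell})$. Assume a Gaussian prior of mean $B_0$ and covariance $W⊛W$ on the elements of a symmetric matrix $B$, and let $Y=BS\in\mathbb{R}^{N\times M}$ be observed without noise. Put $\Delta=Y-B_0S$ and $W_M=W-WS(S^\top WS)^{-1}S^\top W$. Then the Gram matrix $S^\top WS$ is positive definite (so that the inverses exist), $W_M⊛W_M$ is positive semidefinite, and the posterior of $B$ given $Y$ is the (possibly degenerate) Gaussian distribution with mean $$B_M=B_0+\Delta(S^\top WS)^{-1}S^\top W+WS(S^\top WS)^{-1}\Delta^\top-WS(S^\top WS)^{-1}(S^\top\Delta)(S^\top WS)^{-1}S^\top W$$ and covariance $$V_M=W_M⊛W_M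 .$$ This holds in both of the following senses. (i) The Gaussian above is the regular conditional distribution of $B$ given $BS=Y$ under the prior, for almost every $Y$ with respect to the law of $BS$. (ii) For every $Y$ of the form $Y=BS$ with $B$ symmetric, the posterior given by Bayes' theorem for the prior and the likelihood $\mathcal{N}(Y;BS,\Lambda)$, with positive definite noise covariance $\Lambda\in\mathbb{R}^{NM\times NM}$ on the elements of $Y$, converges weakly to the Gaussian above as $\Lambda\to0$. -/

import Mathlib

open MeasureTheory ProbabilityTheory Filter Topology
open scoped Matrix Kronecker ENNReal

namespace MatrixInference

noncomputable section

/-- The elements of a matrix, stacked row after row, as a vector indexed by the pairs `(i, j)`. -/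
def rowVec {N M : ℕ} (A : Matrix (Fin N) (Fin M) ℝ) : EuclideanSpace ℝ (Fin N × Fin M) :=
  WithLp.toLp 2 fun p => A p.1 p.2

/-- The matrix whose vector of elements is `v`. -/
def unvec {N M : ℕ} (v : EuclideanSpace ℝ (Fin N × Fin M)) : Matrix (Fin N) (Fin M) ℝ :=
  Matrix.of fun i j => v (i, j)

theorem unvec_rowVec {N M : ℕ} (A : Matrix (Fin N) (Fin M) ℝ) : unvec (rowVec A) = A := rfl

theorem rowVec_unvec {N M : ℕ} (v : EuclideanSpace ℝ (Fin N × Fin M)) :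
    rowVec (unvec v) = v := rfl

/-- The symmetrization operator on vectorized square matrices, with elements
`(δ_ik δ_jl + δ_il δ_jk) / 2`. -/
def symmetrizer (N : ℕ) : Matrix (Fin N × Fin N) (Fin N × Fin N) ℝ :=
  Matrix.of fun p q =>
    ((if p.1 = q.1 then 1 else 0) * (if p.2 = q.2 then 1 else 0)
      + (if p.1 = q.2 then 1 else 0) * (if p.2 = q.1 then 1 else 0)) / 2

/-- The symmetric Kronecker product `Γ (A ⊗ C) Γᵀ`, with `Γ` the symmetrization operator. -/
def symmKron {N : ℕ} (A C : Matrix (Fin N) (Fin N) ℝ) :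
    Matrix (Fin N × Fin N) (Fin N × Fin N) ℝ :=
  symmetrizer N * (A ⊗ₖ C) * (symmetrizer N)ᵀ

theorem symmetrizer_mulVec {N : ℕ} (A : Matrix (Fin N) (Fin N) ℝ) :
    symmetrizer N *ᵥ (rowVec A).ofLp = (rowVec ((1 / 2 : ℝ) • (A + Aᵀ))).ofLp := by
  ext ⟨i, j⟩
  simp [symmetrizer, rowVec, Matrix.mulVec, dotProduct, Fintype.sum_prod_type, add_mul, add_div,
    Finset.sum_add_distrib, ← ite_and, div_mul_eq_mul_div, ← Finset.sum_div]
  simp [ite_and]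
  ring

theorem symmKron_self_apply {N : ℕ} (W : Matrix (Fin N) (Fin N) ℝ) (i j k l : Fin N) :
    symmKron W W (i, j) (k, l) = (W i k * W j l + W j k * W i l) / 2 := by
  simp [symmKron, symmetrizer, Matrix.mul_apply, Fintype.sum_prod_type, add_mul, mul_add, add_div,
    Finset.sum_add_distrib, div_mul_eq_mul_div, mul_div_assoc', ← Finset.sum_div]
  ring

theorem posSemidef_symmKron_self {N : ℕ} {W : Matrix (Fin N) (Fin N) ℝ} (hW : W.PosSemidef) :
    (symmKron W W).PosSemidef := by
  have h := (hW.kronecker hW).mul_mul_conjTranspose_same (symmetrizer N)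
  rwa [Matrix.conjTranspose_eq_transpose_of_trivial] at h

/-- The Gaussian distribution with mean `B` and covariance matrix `V` on the elements of a square
matrix. -/
def gaussianBelief {N : ℕ} (B : Matrix (Fin N) (Fin N) ℝ)
    (V : Matrix (Fin N × Fin N) (Fin N × Fin N) ℝ) :
    Measure (EuclideanSpace ℝ (Fin N × Fin N)) :=
  multivariateGaussian (rowVec B) V

instance {N : ℕ} (B : Matrix (Fin N) (Fin N) ℝ)
    (V : Matrix (Fin N × Fin N) (Fin N × Fin N) ℝ) :
    IsProbabilityMeasure (gaussianBelief B V) := by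
  unfold gaussianBelief; infer_instance

/-- The observation map `B ↦ B S`, on vectorized matrices. -/
def observe {N M : ℕ} (S : Matrix (Fin N) (Fin M) ℝ) (b : EuclideanSpace ℝ (Fin N × Fin N)) :
    EuclideanSpace ℝ (Fin N × Fin M) :=
  rowVec (unvec b * S)

theorem measurable_observe {N M : ℕ} (S : Matrix (Fin N) (Fin M) ℝ) : Measurable (observe S) := by
  unfold observe rowVec unvec
  simp only [Matrix.mul_apply, Matrix.of_apply]
  fun_prop

/-- The likelihood of a noise-free observation: given `B`, the observed `Y` has the Dirac
distribution at `B S`. -/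
def exactLikelihood {N M : ℕ} (S : Matrix (Fin N) (Fin M) ℝ) :
    Kernel (EuclideanSpace ℝ (Fin N × Fin N)) (EuclideanSpace ℝ (Fin N × Fin M)) :=
  Kernel.deterministic (observe S) (measurable_observe S)

instance {N M : ℕ} (S : Matrix (Fin N) (Fin M) ℝ) : IsMarkovKernel (exactLikelihood S) := by
  unfold exactLikelihood; infer_instance

/-- The density at `x` of the Gaussian distribution with mean `μ` and positive definite covariance
matrix `C`. -/
def gaussianDensity {ι : Type*} [Fintype ι] [DecidableEq ι] (x μ : EuclideanSpace ℝ ι)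
    (C : Matrix ι ι ℝ) : ℝ :=
  1 / ((2 * Real.pi) ^ ((Fintype.card ι : ℝ) / 2) * Real.sqrt C.det)
    * Real.exp (-(1 / 2) * ((x - μ).ofLp ⬝ᵥ (C⁻¹ *ᵥ (x - μ).ofLp)))

/-- Bayes' theorem for a prior `π` and a likelihood density `ℓ` of the datum: the posterior is
the prior, reweighted by the likelihood and normalized. -/
def bayesPosterior {E : Type*} [MeasurableSpace E] (π : Measure E) (ℓ : E → ℝ) : Measure E :=
  (∫⁻ v, ENNReal.ofReal (ℓ v) ∂π)⁻¹ • π.withDensity fun v => ENNReal.ofReal (ℓ v)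

/-- The posterior mean `B_M` from the prior mean `B₀`, with residual `Δ = Y - B₀ S` and Gram matrix
`Sᵀ W S`. -/
def posteriorMean {N M : ℕ} (B₀ W : Matrix (Fin N) (Fin N) ℝ) (S Y : Matrix (Fin N) (Fin M) ℝ) :
    Matrix (Fin N) (Fin N) ℝ :=
  B₀ + (Y - B₀ * S) * (Sᵀ * W * S)⁻¹ * Sᵀ * W
    + W * S * (Sᵀ * W * S)⁻¹ * (Y - B₀ * S)ᵀ
    - W * S * (Sᵀ * W * S)⁻¹ * (Sᵀ * (Y - B₀ * S)) * (Sᵀ * W * S)⁻¹ * Sᵀ * W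

/-- The Schur complement `W_M = W - W S (Sᵀ W S)⁻¹ Sᵀ W`. -/
def posteriorFactor {N M : ℕ} (W : Matrix (Fin N) (Fin N) ℝ) (S : Matrix (Fin N) (Fin M) ℝ) :
    Matrix (Fin N) (Fin N) ℝ :=
  W - W * S * (Sᵀ * W * S)⁻¹ * Sᵀ * W

end

end MatrixInference

open MatrixInference

/-! Write a prior draw as `B₀ + b`, where `b` is the symmetric root of `W ⊛ W` applied to a standard
Gaussian `v`, and put `Π = 1 - W S (Sᵀ W S)⁻¹ Sᵀ`, so that `Π W S = 0`. For symmetric `b`, the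
difference `b - Π b Πᵀ` depends only on `b S`, and adding `B₀` to it gives exactly `B_M`
(`posteriorMean_add_mul`). The remainder `Π b Πᵀ` is uncorrelated with `b S` because `Π W S = 0`,
hence independent of it by joint Gaussianity. Conditioning on `Y` therefore freezes `B_M` and leaves
the law of the remainder untouched; its covariance is `W_M ⊛ W_M` since `Π W Πᵀ = W_M`. This is (i),
by `posterior_deterministic_ae_eq`.

For (ii), pull back to the standard Gaussian: `A z` is observed at `A z₀` with noise `Λ`. Completing
the square, the posterior is the law of `z₀ - K² z₀ + K v` with `K = (1 + A† Λ⁻¹ A)^(-1/2)`. This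
`K` fixes `ker A`, and `‖K A† x‖² ≤ xᵀ Λ x`, so `K` tends pointwise to the orthogonal projection `P`
onto `ker A`, however `Λ` tends to `0` (`exists_posterior_affine`, `tendsto_integral_exp_div`). The
limit `z₀ - P z₀ + P v` has observation `A z₀` and the same remainder as `v`, so it yields the
Gaussian of (i). Surjectivity of `A` is not required. -/

namespace MatrixInference

open scoped RealInnerProductSpace

/-! ### Gaussian densities under affine maps. -/

section Gaussian

variable {E : Type*} [NormedAddCommGroup E] [InnerProductSpace ℝ E] [FiniteDimensional ℝ E]
  [MeasurableSpace E] [BorelSpace E]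

/-- The standard Gaussian has density proportional to `exp (-‖v‖ ^ 2 / 2)`. -/
theorem exists_stdGaussian_eq_smul_withDensity : ∃ c : ℝ≥0∞,
    stdGaussian E
      = c • (volume : Measure E).withDensity (fun v => ENNReal.ofReal (Real.exp (-‖v‖ ^ 2 / 2))) := by
  set ν : Measure E := volume.withDensity (fun v => ENNReal.ofReal (Real.exp (-‖v‖ ^ 2 / 2)))
    with hν
  set J : ℝ := (2 * Real.pi) ^ (Module.finrank ℝ E / 2 : ℝ) with hJ
  have hJ0 : 0 < J := by positivity
  have hint : ∫ v : E, Real.exp (-‖v‖ ^ 2 / 2) = J := by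
    have := GaussianFourier.integral_rexp_neg_mul_sq_norm (V := E) (b := 1 / 2) (by norm_num)
    rw [hJ, show 2 * Real.pi = Real.pi / (1 / 2) by ring, ← this]
    congr 1; ext v; congr 1; ring
  -- A non-integrable function has integral `0` by convention, but the value `J` is positive.
  have hI : Integrable (fun v : E => Real.exp (-‖v‖ ^ 2 / 2)) := by
    by_contra h
    rw [integral_undef h] at hint
    exact hJ0.ne hint
  have hmass : ν Set.univ = ENNReal.ofReal J := by
    rw [hν, withDensity_apply _ MeasurableSet.univ, setLIntegral_univ, ← hint,
      ofReal_integral_eq_lintegral_ofReal hI (ae_of_all _ fun v => (Real.exp_pos _).le)]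
  refine ⟨ENNReal.ofReal J⁻¹, ?_⟩
  have : IsFiniteMeasure ν := ⟨by rw [hmass]; exact ENNReal.ofReal_lt_top⟩
  have : IsFiniteMeasure (ENNReal.ofReal J⁻¹ • ν) := ν.smul_finite ENNReal.ofReal_ne_top
  apply Measure.ext_of_charFun
  ext t
  rw [charFun_stdGaussian, charFun_apply, integral_smul_measure, hν,
    integral_withDensity_eq_integral_toReal_smul (by fun_prop) (by simp)]
  have key := GaussianFourier.integral_cexp_neg_mul_sq_norm_add (V := E) (b := 1 / 2)
    (by norm_num) Complex.I t
  have h1 : ∀ v : E, (ENNReal.ofReal (Real.exp (-‖v‖ ^ 2 / 2))).toReal •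
      Complex.exp (⟪v, t⟫ * Complex.I)
      = Complex.exp (-(1 / 2) * ‖v‖ ^ 2 + Complex.I * ⟪t, v⟫) := by
    intro v
    rw [ENNReal.toReal_ofReal (Real.exp_pos _).le, Complex.real_smul, Complex.ofReal_exp,
      ← Complex.exp_add, real_inner_comm]
    congr 1; push_cast; ring
  simp_rw [h1]
  rw [key, ENNReal.toReal_ofReal (by positivity), Complex.real_smul, ← mul_assoc]
  have h2 : ((J⁻¹ : ℝ) : ℂ) * ((Real.pi : ℂ) / (1 / 2)) ^ (Module.finrank ℝ E / 2 : ℂ) = 1 := by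
    rw [show (Real.pi : ℂ) / (1 / 2) = ((2 * Real.pi : ℝ) : ℂ) by push_cast; ring,
      show (Module.finrank ℝ E / 2 : ℂ) = ((Module.finrank ℝ E / 2 : ℝ) : ℂ) by push_cast; rfl,
      ← Complex.ofReal_cpow (by positivity), ← hJ, ← Complex.ofReal_mul,
      inv_mul_cancel₀ hJ0.ne', Complex.ofReal_one]
  rw [h2, one_mul, Complex.I_sq]
  congr 1; ring

/-- Reweighting the standard Gaussian by the exponential of a quadratic function that completes
its density to that of an affine image gives, up to a factor, that image. -/
theorem exists_integral_stdGaussian_mul_exp_eq (K : E →L[ℝ] E) (hK : Function.Bijective K)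
    (m : E) (q : E → ℝ) (a : ℝ)
    (hq : ∀ v, ‖m + K v‖ ^ 2 / 2 + q (m + K v) = ‖v‖ ^ 2 / 2 + a) :
    ∃ c : ℝ, ∀ f : E → ℝ, ∫ z, Real.exp (-q z) * f z ∂(stdGaussian E)
      = c * ∫ v, f (m + K v) ∂(stdGaussian E) := by
  obtain ⟨c₀, hc₀⟩ := exists_stdGaussian_eq_smul_withDensity (E := E)
  have hgauss : ∀ g : E → ℝ, ∫ z, g z ∂(stdGaussian E)
      = c₀.toReal * ∫ z, Real.exp (-‖z‖ ^ 2 / 2) * g z := by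
    intro g
    rw [hc₀, integral_smul_measure,
      integral_withDensity_eq_integral_toReal_smul (by fun_prop) (by simp)]
    simp [ENNReal.toReal_ofReal (Real.exp_pos _).le]
  have hdet : LinearMap.det (K : E →ₗ[ℝ] E) ≠ 0 := by
    have := LinearEquiv.isUnit_det' (LinearEquiv.ofBijective (K : E →ₗ[ℝ] E) hK)
    exact this.ne_zero
  have hemb : MeasurableEmbedding fun v => m + K v := by
    have h := ((LinearEquiv.ofBijective (K : E →ₗ[ℝ] E)
      hK).toContinuousLinearEquiv.toHomeomorph.trans (Homeomorph.addLeft m)).measurableEmbedding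
    exact h
  have hcv : ∀ g : E → ℝ, ∫ v, g (m + K v)
      = (ENNReal.ofReal |(LinearMap.det (K : E →ₗ[ℝ] E))⁻¹|).toReal * ∫ z, g z := by
    intro g
    rw [← hemb.integral_map, show (fun v => m + K v) = (fun z => m + z) ∘ K from rfl,
      ← Measure.map_map (by fun_prop) (by fun_prop)]
    have := Measure.map_linearMap_addHaar_eq_smul_addHaar (volume : Measure E) hdet
    rw [show (K : E → E) = ((K : E →ₗ[ℝ] E) : E → E) from rfl, this, Measure.map_smul,
      map_add_left_eq_self, integral_smul_measure, smul_eq_mul]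
  set d := (ENNReal.ofReal |(LinearMap.det (K : E →ₗ[ℝ] E))⁻¹|).toReal
  have hd : d ≠ 0 := by
    simp only [d]
    rw [ENNReal.toReal_ofReal (abs_nonneg _)]
    exact abs_ne_zero.2 (inv_ne_zero hdet)
  -- The Jacobian `|det K|` times the constant left over from completing the square.
  refine ⟨d⁻¹ * Real.exp (-a), fun f => ?_⟩
  rw [hgauss, hgauss]
  have h := hcv fun z => Real.exp (-‖z‖ ^ 2 / 2) * (Real.exp (-q z) * f z)
  rw [eq_comm, ← eq_inv_mul_iff_mul_eq₀ hd] at h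
  rw [h]
  have : ∀ v, Real.exp (-‖m + K v‖ ^ 2 / 2) * (Real.exp (-q (m + K v)) * f (m + K v))
      = Real.exp (-a) * (Real.exp (-‖v‖ ^ 2 / 2) * f (m + K v)) := by
    intro v
    rw [← mul_assoc, ← mul_assoc, ← Real.exp_add, ← Real.exp_add]
    congr 2
    linarith [hq v]
  simp_rw [this, integral_const_mul]
  ring

end Gaussian

/-- The inverse square root of `1 + G` for positive `G`. -/
theorem exists_inv_sqrt_one_add {n : Type*} [Fintype n] [DecidableEq n]
    (G : EuclideanSpace ℝ n →L[ℝ] EuclideanSpace ℝ n) (hG : ∀ x y, ⟪G x, y⟫ = ⟪x, G y⟫)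
    (hG0 : ∀ x, 0 ≤ ⟪x, G x⟫) :
    ∃ K : EuclideanSpace ℝ n →L[ℝ] EuclideanSpace ℝ n,
      (∀ x y, ⟪K x, y⟫ = ⟪x, K y⟫) ∧ Function.Bijective K ∧
      (∀ v, K (K v + G (K v)) = v) ∧ ∀ p, G p = 0 → K p = p := by
  open scoped MatrixOrder in
  set R : Matrix n n ℝ := (Matrix.toEuclideanCLM (n := n) (𝕜 := ℝ)).symm G with hR
  have hRG : Matrix.toEuclideanCLM (n := n) (𝕜 := ℝ) R = G := by simp [hR]
  have hRpos : R.PosSemidef := by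
    rw [← Matrix.isPositive_toEuclideanLin_iff, ← Matrix.coe_toEuclideanCLM_eq_toEuclideanLin, hRG]
    refine ⟨fun x y => hG x y, fun x => ?_⟩
    rw [real_inner_comm]
    exact hG0 x
  have hSpos : (1 + R).PosSemidef := Matrix.PosSemidef.one.add hRpos
  obtain ⟨Q, hQpos, hQQ⟩ : ∃ Q : Matrix n n ℝ, Q.PosSemidef ∧ Q * Q = 1 + R :=
    ⟨CFC.sqrt (1 + R), Matrix.nonneg_iff_posSemidef.1 (CFC.sqrt_nonneg _),
      CFC.sqrt_mul_sqrt_self _ hSpos.nonneg⟩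
  set q := Matrix.toEuclideanCLM (n := n) (𝕜 := ℝ) Q with hq
  have hqpos : (q : EuclideanSpace ℝ n →ₗ[ℝ] EuclideanSpace ℝ n).IsPositive := by
    rw [hq, Matrix.coe_toEuclideanCLM_eq_toEuclideanLin]
    exact Matrix.isPositive_toEuclideanLin_iff.2 hQpos
  have hsymm : ∀ x y, ⟪q x, y⟫ = ⟪x, q y⟫ := hqpos.1
  have hq0 : ∀ x, 0 ≤ ⟪q x, x⟫ := hqpos.2
  have hqq : ∀ v, q (q v) = v + G v := by
    intro v
    have h : q * q = 1 + G := by rw [hq, ← map_mul, hQQ, map_add, map_one, hRG]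
    simpa using congrArg (fun T => T v) h
  have hinj : Function.Injective (q : EuclideanSpace ℝ n →ₗ[ℝ] EuclideanSpace ℝ n) := by
    rw [injective_iff_map_eq_zero]
    intro x hx
    have h1 : q x = 0 := hx
    have h2 := hqq x
    rw [h1, map_zero] at h2
    have h3 : ⟪x, x + G x⟫ = 0 := by rw [← h2, inner_zero_right]
    rw [inner_add_right] at h3
    have h4 := hG0 x
    have h5 : ⟪x, x⟫ = 0 := le_antisymm (by linarith) real_inner_self_nonneg
    exact inner_self_eq_zero.1 h5
  set e := (LinearEquiv.ofInjectiveEndo _ hinj).toContinuousLinearEquiv with he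
  have heq : ∀ v, e v = q v := fun v => rfl
  have hqe : ∀ v, q (e.symm v) = v := fun v => by rw [← heq, e.apply_symm_apply]
  have heq' : ∀ v, e.symm (q v) = v := fun v => by rw [← heq, e.symm_apply_apply]
  refine ⟨e.symm, fun x y => ?_, e.symm.bijective, fun v => ?_, fun p hp => ?_⟩
  · change ⟪e.symm x, y⟫ = ⟪x, e.symm y⟫
    conv_lhs => rw [← hqe y]
    rw [← hsymm, hqe]
  · change e.symm (e.symm v + G (e.symm v)) = v
    rw [← hqq, hqe, heq']
  · change e.symm p = p
    -- From `q (q p) = p`, the vector `q p - p` is mapped to its negative, which positivity of `q`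
    -- allows only for zero.
    have h1 : q p = p := by
      have h2 := hqq p
      rw [hp, add_zero] at h2
      have h3 : q (q p - p) = -(q p - p) := by rw [map_sub, h2]; abel
      have h4 := hq0 (q p - p)
      rw [h3, inner_neg_left] at h4
      have h5 : ⟪q p - p, q p - p⟫ = 0 := le_antisymm (by linarith) real_inner_self_nonneg
      exact sub_eq_zero.1 (inner_self_eq_zero.1 h5)
    simpa only [h1] using heq' p

/-! ### Posterior under small Gaussian noise, and its limit. -/

section Concentration

variable {n : Type*} [Fintype n] [DecidableEq n] {F : Type*} [NormedAddCommGroup F]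
  [InnerProductSpace ℝ F] [FiniteDimensional ℝ F]

/-- For a standard Gaussian prior on `z` and a Gaussian likelihood of `A z` around `A z₀` with
covariance `C`, the posterior is an affine image of the standard Gaussian. On the range of `A†`,
the linear part is small when `C` is, and it is the identity on the kernel of `A`. -/
theorem exists_posterior_affine (A : EuclideanSpace ℝ n →L[ℝ] F) (C P : F →L[ℝ] F)
    (hP : ∀ x y, ⟪P x, y⟫ = ⟪x, P y⟫) (hP0 : ∀ x, 0 ≤ ⟪x, P x⟫) (hPC : ∀ x, P (C x) = x)
    (z₀ : EuclideanSpace ℝ n) :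
    ∃ K : EuclideanSpace ℝ n →L[ℝ] EuclideanSpace ℝ n,
      (∀ x, ‖K x‖ ≤ ‖x‖) ∧ (∀ p, A p = 0 → K p = p) ∧
      (∀ x, ‖K (A.adjoint x)‖ ^ 2 ≤ ⟪x, C x⟫) ∧
      ∃ c : ℝ, ∀ f : EuclideanSpace ℝ n → ℝ,
        ∫ z, Real.exp (-(1 / 2 * ⟪A (z - z₀), P (A (z - z₀))⟫)) * f z ∂(stdGaussian _)
          = c * ∫ v, f (z₀ - K (K z₀) + K v) ∂(stdGaussian _) := by
  set G := A.adjoint ∘L P ∘L A with hGdef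
  have hG : ∀ x y, ⟪G x, y⟫ = ⟪P (A x), A y⟫ := fun x y => by
    simp [hGdef, ContinuousLinearMap.adjoint_inner_left]
  have hG' : ∀ x y, ⟪x, G y⟫ = ⟪A x, P (A y)⟫ := fun x y => by
    simp [hGdef, ContinuousLinearMap.adjoint_inner_right]
  obtain ⟨K, hsymm, hbij, hKGK, hKp⟩ := exists_inv_sqrt_one_add G
    (fun x y => by rw [hG, hG', hP]) (fun x => by rw [hG']; exact hP0 _)
  have hGKK : ∀ v, K (K v) + G (K (K v)) = v := fun v => hbij.1 (hKGK (K v))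
  have hnorm : ∀ v, ‖K v‖ ^ 2 + ⟪K v, G (K v)⟫ = ‖v‖ ^ 2 := by
    intro v
    rw [← real_inner_self_eq_norm_sq, ← inner_add_right, hsymm, hKGK, real_inner_self_eq_norm_sq]
  refine ⟨K, fun x => ?_, fun p hp => hKp p (by simp [hGdef, hp]), fun x => ?_, ?_⟩
  · have h1 := hnorm x
    have h2 : 0 ≤ ⟪K x, G (K x)⟫ := by rw [hG']; exact hP0 _
    exact le_of_sq_le_sq (by linarith) (norm_nonneg _)
  -- Here `w` solves `(1 + G) w = A† x`, so `⟪x, A w⟫ = ‖w‖² + ⟪A w, P (A w)⟫`. Positivity of `P` at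
  -- `A w - C x` then gives `⟪x, A w⟫ ≤ ⟪x, C x⟫ - ‖w‖²`.
  · set w := K (K (A.adjoint x)) with hw
    have h1 : ‖K (A.adjoint x)‖ ^ 2 = ⟪x, A w⟫ := by
      rw [← real_inner_self_eq_norm_sq, hsymm, ContinuousLinearMap.adjoint_inner_left]
    have h2 : ⟪x, A w⟫ = ‖w‖ ^ 2 + ⟪A w, P (A w)⟫ := by
      rw [← ContinuousLinearMap.adjoint_inner_left, ← hGKK (A.adjoint x), inner_add_left, hG,
        real_inner_self_eq_norm_sq, hP]
    have h3 := hP0 (A w - C x)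
    rw [map_sub, hPC, inner_sub_left, inner_sub_right, inner_sub_right, ← hP (C x), hPC,
      real_inner_comm x (A w), real_inner_comm x (C x)] at h3
    rw [h1]
    nlinarith [sq_nonneg ‖w‖]
  -- The posterior precision is `1 + G = K⁻²`, and its mean is `K² G z₀ = z₀ - K² z₀`.
  · refine exists_integral_stdGaussian_mul_exp_eq K hbij (z₀ - K (K z₀)) _
      ((‖z₀‖ ^ 2 - ‖K z₀‖ ^ 2) / 2) fun v => ?_
    have hz : z₀ - K (K z₀) + K v - z₀ = K (v - K z₀) := by rw [map_sub]; abel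
    have h1 := hnorm (v - K z₀)
    have h2 : z₀ - K (K z₀) + K v = K (v - K z₀) + z₀ := by rw [← hz]; abel
    rw [hz, h2, norm_add_sq_real, ← hG', hsymm, inner_sub_left]
    rw [norm_sub_sq_real] at h1
    rw [real_inner_self_eq_norm_sq]
    linarith

end Concentration

section Concentration

variable {n m : Type*} [Fintype n] [DecidableEq n] [Fintype m] [DecidableEq m]

/-- Vanishing-noise limit of the posterior of a standard Gaussian vector `z`, when `A z` is observed
at a point of the range of `A`: the components of `z` outside the kernel of `A` become exact. -/
theorem tendsto_integral_exp_div (A : EuclideanSpace ℝ n →L[ℝ] EuclideanSpace ℝ m)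
    (z₀ : EuclideanSpace ℝ n) (P : EuclideanSpace ℝ n → EuclideanSpace ℝ n)
    (hAP : ∀ v, A (P v) = 0) (hP : ∀ v, ∃ x, v = P v + A.adjoint x)
    (f : BoundedContinuousFunction (EuclideanSpace ℝ n) ℝ) :
    Tendsto (fun Λ : Matrix m m ℝ =>
      (∫ z, Real.exp (-(1 / 2 * ((A (z - z₀)).ofLp ⬝ᵥ (Λ⁻¹ *ᵥ (A (z - z₀)).ofLp)))) * f z
          ∂(stdGaussian (EuclideanSpace ℝ n)))
        / ∫ z, Real.exp (-(1 / 2 * ((A (z - z₀)).ofLp ⬝ᵥ (Λ⁻¹ *ᵥ (A (z - z₀)).ofLp))))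
          ∂(stdGaussian (EuclideanSpace ℝ n)))
      (𝓝[{Λ | Λ.PosDef}] 0)
      (𝓝 (∫ v, f (z₀ - P z₀ + P v) ∂(stdGaussian (EuclideanSpace ℝ n)))) := by
  set T := Matrix.toEuclideanCLM (n := m) (𝕜 := ℝ) with hT
  have hex : ∀ Λ : Matrix m m ℝ, Λ.PosDef →
      ∃ K : EuclideanSpace ℝ n →L[ℝ] EuclideanSpace ℝ n,
      (∀ x, ‖K x‖ ≤ ‖x‖) ∧ (∀ p, A p = 0 → K p = p) ∧
      (∀ x, ‖K (A.adjoint x)‖ ^ 2 ≤ ⟪x, T Λ x⟫) ∧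
      ∃ c : ℝ, ∀ f : EuclideanSpace ℝ n → ℝ,
        ∫ z, Real.exp (-(1 / 2 * ⟪A (z - z₀), T Λ⁻¹ (A (z - z₀))⟫)) * f z ∂(stdGaussian _)
          = c * ∫ v, f (z₀ - K (K z₀) + K v) ∂(stdGaussian _) := by
    intro Λ hΛ
    have hpos : (Matrix.toEuclideanLin Λ⁻¹).IsPositive :=
      Matrix.isPositive_toEuclideanLin_iff.2 hΛ.inv.posSemidef
    refine exists_posterior_affine A (T Λ) (T Λ⁻¹) (fun x y => hpos.1 x y)
      (fun x => ?_) (fun x => ?_) z₀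
    · rw [real_inner_comm]; exact hpos.2 x
    · have h : T Λ⁻¹ * T Λ = 1 := by
        rw [← map_mul, Matrix.nonsing_inv_mul _ hΛ.det_pos.ne'.isUnit, map_one]
      simpa using congrArg (fun U => U x) h
  choose! K hK1 hKp hKA hKc using hex
  have hKlim : ∀ v, Tendsto (fun Λ => K Λ v) (𝓝[{Λ | Λ.PosDef}] 0) (𝓝 (P v)) := by
    intro v
    obtain ⟨x, hx⟩ := hP v
    rw [tendsto_iff_norm_sub_tendsto_zero]
    have hlim : Tendsto (fun Λ : Matrix m m ℝ => √(x.ofLp ⬝ᵥ (Λ *ᵥ x.ofLp)))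
        (𝓝[{Λ | Λ.PosDef}] 0) (𝓝 0) := by
      have hc : Continuous fun Λ : Matrix m m ℝ => √(x.ofLp ⬝ᵥ (Λ *ᵥ x.ofLp)) := by
        fun_prop
      have := hc.tendsto 0
      simp only [Matrix.zero_mulVec, dotProduct_zero, Real.sqrt_zero] at this
      exact this.mono_left nhdsWithin_le_nhds
    refine squeeze_zero' (Eventually.of_forall fun _ => norm_nonneg _) ?_ hlim
    filter_upwards [self_mem_nhdsWithin] with Λ hΛ
    have h1 : K Λ v - P v = K Λ (A.adjoint x) := by
      conv_lhs => rw [hx, map_add, hKp Λ hΛ _ (hAP v), ← hx]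
      abel
    have h2 := hKA Λ hΛ x
    rw [h1]
    apply Real.le_sqrt_of_sq_le
    rwa [Matrix.inner_toEuclideanCLM] at h2
  have hmlim : Tendsto (fun Λ => z₀ - K Λ (K Λ z₀)) (𝓝[{Λ | Λ.PosDef}] 0) (𝓝 (z₀ - P z₀)) := by
    refine tendsto_const_nhds.sub ?_
    have h := hKlim z₀
    rw [tendsto_iff_norm_sub_tendsto_zero] at h ⊢
    refine squeeze_zero' (Eventually.of_forall fun _ => norm_nonneg _) ?_ h
    filter_upwards [self_mem_nhdsWithin] with Λ hΛ
    -- Since `K` fixes `P z₀` and is a contraction, the second application of `K` costs nothing.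
    have h1 : K Λ (K Λ z₀) - P z₀ = K Λ (K Λ z₀ - P z₀) := by
      rw [map_sub, hKp Λ hΛ _ (hAP z₀)]
    rw [h1]
    exact hK1 Λ hΛ _
  have hlim : Tendsto (fun Λ => ∫ v, f (z₀ - K Λ (K Λ z₀) + K Λ v)
      ∂(stdGaussian (EuclideanSpace ℝ n))) (𝓝[{Λ | Λ.PosDef}] 0)
      (𝓝 (∫ v, f (z₀ - P z₀ + P v) ∂(stdGaussian (EuclideanSpace ℝ n)))) := by
    -- Dominated convergence along a filter needs it to be countably generated.
    have : FirstCountableTopology (Matrix m m ℝ) :=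
      inferInstanceAs (FirstCountableTopology (m → m → ℝ))
    refine tendsto_integral_filter_of_dominated_convergence (fun _ => ‖f‖) ?_ ?_ ?_ ?_
    · refine Eventually.of_forall fun Λ => Continuous.aestronglyMeasurable ?_
      fun_prop
    · exact Eventually.of_forall fun Λ => Eventually.of_forall fun v => f.norm_coe_le_norm _
    · exact integrable_const _
    · refine Eventually.of_forall fun v => ?_
      exact (f.continuous.tendsto _).comp (hmlim.add (hKlim v))
  refine hlim.congr' ?_
  filter_upwards [self_mem_nhdsWithin] with Λ hΛ
  obtain ⟨c, hc⟩ := hKc Λ hΛ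
  simp_rw [hT, Matrix.inner_toEuclideanCLM] at hc
  have h1 := hc fun _ => 1
  simp only [mul_one, integral_const, probReal_univ, smul_eq_mul] at h1
  -- Testing with `f = 1` identifies `c` as the evidence, the integral of a positive function.
  have hc0 : c ≠ 0 := by
    rw [← h1]
    refine (integral_pos_iff_support_of_nonneg (fun _ => (Real.exp_pos _).le) ?_).2 ?_ |>.ne'
    · refine Integrable.of_bound (Continuous.aestronglyMeasurable (by fun_prop)) 1
        (Eventually.of_forall fun z => ?_)
      rw [Real.norm_eq_abs, Real.abs_exp, Real.exp_le_one_iff]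
      have := hΛ.inv.posSemidef.dotProduct_mulVec_nonneg (A (z - z₀)).ofLp
      rw [star_trivial] at this
      linarith
    · rw [show Function.support _ = Set.univ from
        Set.eq_univ_of_forall fun z => (Real.exp_pos _).ne']
      simp
  rw [h1, hc, mul_div_cancel_left₀ _ hc0]

end Concentration

/-! ### Conditioning on a noise-free observation. -/

section Exact

variable {E F : Type*} [NormedAddCommGroup E] [InnerProductSpace ℝ E] [FiniteDimensional ℝ E]
  [MeasurableSpace E] [BorelSpace E] [NormedAddCommGroup F] [InnerProductSpace ℝ F]
  [FiniteDimensional ℝ F] [MeasurableSpace F] [BorelSpace F]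

/-- Linear images `A v` and `D v` of a standard Gaussian vector with `D A† = 0` are independent. -/
theorem indepFun_stdGaussian_of_comp_adjoint_eq_zero {F' : Type*} [NormedAddCommGroup F']
    [InnerProductSpace ℝ F'] [FiniteDimensional ℝ F'] [MeasurableSpace F'] [BorelSpace F']
    (A : E →L[ℝ] F) (D : E →L[ℝ] F')
    (hDA : ∀ x, D (A.adjoint x) = 0) : IndepFun A D (stdGaussian E) := by
  have hid : HasGaussianLaw (id : E → E) (stdGaussian E) := ⟨by
    rw [Measure.map_id]; infer_instance⟩
  refine HasGaussianLaw.indepFun_of_covariance_inner (hid.map (A.prod D)) fun x y => ?_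
  have h1 : (fun v => ⟪x, A v⟫) = fun v => ⟪A.adjoint x, v⟫ := by
    ext v; rw [ContinuousLinearMap.adjoint_inner_left]
  have h2 : (fun v => ⟪y, D v⟫) = fun v => ⟪D.adjoint y, v⟫ := by
    ext v; rw [ContinuousLinearMap.adjoint_inner_left]
  rw [h1, h2, ← covarianceBilin_apply_eq_cov IsGaussian.memLp_two_id,
    covarianceBilin_stdGaussian, innerSL_apply_apply, ContinuousLinearMap.adjoint_inner_right,
    hDA, inner_zero_left]

/-- If `b = g (h b) + D v` with `D v` independent of the observation `h b`, then the posterior of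
`b` given `h b = y` is the law of `g y + D v`. -/
theorem posterior_deterministic_ae_eq (L : E → F) (hL : Measurable L) {F' : Type*}
    [NormedAddCommGroup F']
    [InnerProductSpace ℝ F'] [FiniteDimensional ℝ F'] [MeasurableSpace F'] [BorelSpace F']
    (A : E →L[ℝ] F') (D : E →L[ℝ] F) (hDA : ∀ x, D (A.adjoint x) = 0)
    (h : F → F') (hh : Measurable h) (y₀ : F') (g : F' → F) (hg : Measurable g)
    (hobs : ∀ v, h (L v) = y₀ + A v) (hdec : ∀ v, L v = g (h (L v)) + D v) :
    ∀ᵐ y ∂(((stdGaussian E).map L).map h),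
      posterior (Kernel.deterministic h hh) ((stdGaussian E).map L) y
        = (stdGaussian E).map fun v => g y + D v := by
  set γ := stdGaussian E
  have : IsProbabilityMeasure (γ.map L) := Measure.isProbabilityMeasure_map hL.aemeasurable
  set η : Kernel F' F := (Kernel.id ×ₖ Kernel.const F' γ).map (fun p => g p.1 + D p.2) with hη
  have hmeas : Measurable (fun p : F' × E => g p.1 + D p.2) := by fun_prop
  have hηy : ∀ y, η y = γ.map fun v => g y + D v := by
    intro y
    rw [hη, Kernel.map_apply _ hmeas, Kernel.prod_apply, Kernel.id_apply, Kernel.const_apply,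
      Measure.dirac_prod, Measure.map_map hmeas (by fun_prop)]
    rfl
  have hη_markov : IsMarkovKernel η := Kernel.IsMarkovKernel.map _ hmeas
  -- The posterior is characterized by the joint law of observation and draw. That law is the image
  -- of the product law of `(A v, D v)`, by independence, and integrating out `D v` first exhibits
  -- `η`.
  have key : (Kernel.deterministic h hh ∘ₘ γ.map L) ⊗ₘ η
      = ((γ.map L) ⊗ₘ Kernel.deterministic h hh).map Prod.swap := by
    rw [Measure.deterministic_comp_eq_map, Measure.compProd_deterministic]
    have hΦ : Measurable fun p : F' × F => (y₀ + p.1, g (y₀ + p.1) + p.2) := by fun_prop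
    have hobs' : (γ.map L).map h = γ.map fun v => y₀ + A v := by
      rw [Measure.map_map hh hL]; exact congrArg γ.map (funext hobs)
    have hind := (indepFun_iff_map_prod_eq_prod_map_map (by fun_prop) (by fun_prop)).1
      (indepFun_stdGaussian_of_comp_adjoint_eq_zero A D hDA)
    have hR : ((γ.map L).map fun a => (a, h a)).map Prod.swap
        = ((γ.map A).prod (γ.map D)).map fun p => (y₀ + p.1, g (y₀ + p.1) + p.2) := by
      rw [← hind, Measure.map_map measurable_swap (by fun_prop),
        Measure.map_map (by fun_prop) hL, Measure.map_map hΦ (by fun_prop)]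
      refine congrArg γ.map (funext fun v => ?_)
      simp only [Function.comp_apply, Prod.swap_prod_mk, ← hobs, ← hdec]
    rw [hR, hobs']
    ext s hs
    rw [Measure.compProd_apply hs, Measure.map_apply hΦ hs, Measure.prod_apply (hΦ hs),
      lintegral_map (Kernel.measurable_kernel_prodMk_left hs) (by fun_prop),
      lintegral_map (measurable_measure_prodMk_left (hΦ hs)) (by fun_prop)]
    refine lintegral_congr fun v => ?_
    rw [hηy, Measure.map_apply (by fun_prop) (measurable_prodMk_left hs),
      Measure.map_apply (by fun_prop) (measurable_prodMk_left (hΦ hs))]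
    rfl
  have := ae_eq_posterior_of_compProd_eq key
  rw [Measure.deterministic_comp_eq_map] at this
  filter_upwards [this] with y hy
  rw [← hy, hηy]

end Exact

/-! ### Oblique projection and Schur complement. -/

variable {N M : ℕ}

/-- Full column rank makes `S` injective, and congruence by an injective map preserves definiteness.
-/
theorem posDef_gram {W : Matrix (Fin N) (Fin N) ℝ} {S : Matrix (Fin N) (Fin M) ℝ}
    (hW : W.PosDef) (hS : S.rank = M) : (Sᵀ * W * S).PosDef := by
  have hli : LinearIndependent ℝ S.col := by
    rw [linearIndependent_iff_card_eq_finrank_span, Fintype.card_fin, Set.finrank,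
      ← Matrix.rank_eq_finrank_span_cols, hS]
  have h := hW.conjTranspose_mul_mul_same (Matrix.mulVec_injective_iff.2 hli)
  rwa [Matrix.conjTranspose_eq_transpose_of_trivial] at h

/-- The projection `1 - W S (Sᵀ W S)⁻¹ Sᵀ`, which annihilates `W S`. -/
noncomputable def obliqueProj (W : Matrix (Fin N) (Fin N) ℝ) (S : Matrix (Fin N) (Fin M) ℝ) :
    Matrix (Fin N) (Fin N) ℝ :=
  1 - W * S * (Sᵀ * W * S)⁻¹ * Sᵀ

section Algebra

variable {W : Matrix (Fin N) (Fin N) ℝ} {S : Matrix (Fin N) (Fin M) ℝ}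

theorem obliqueProj_mul_mul (hG : (Sᵀ * W * S).PosDef) : obliqueProj W S * (W * S) = 0 := by
  have h : (Sᵀ * W * S)⁻¹ * (Sᵀ * W * S) = 1 := Matrix.nonsing_inv_mul _ hG.det_pos.ne'.isUnit
  have h2 : W * S * (Sᵀ * W * S)⁻¹ * Sᵀ * (W * S)
      = W * S * ((Sᵀ * W * S)⁻¹ * (Sᵀ * W * S)) := by simp only [Matrix.mul_assoc]
  rw [obliqueProj, Matrix.sub_mul, Matrix.one_mul, h2, h, Matrix.mul_one, sub_self]

theorem transpose_mul_mul_obliqueProj_transpose (hW : W.IsSymm) (hG : (Sᵀ * W * S).PosDef) :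
    Sᵀ * (W * (obliqueProj W S)ᵀ) = 0 := by
  have h := congrArg Matrix.transpose (obliqueProj_mul_mul hG)
  simpa [Matrix.transpose_mul, hW.eq, Matrix.mul_assoc] using h

theorem posteriorFactor_eq_obliqueProj_mul : posteriorFactor W S = obliqueProj W S * W := by
  rw [posteriorFactor, obliqueProj, Matrix.sub_mul, Matrix.one_mul]

theorem transpose_obliqueProj (hW : W.IsSymm) :
    (obliqueProj W S)ᵀ = 1 - S * (Sᵀ * W * S)⁻¹ * Sᵀ * W := by
  simp [obliqueProj, Matrix.transpose_nonsing_inv, hW.eq, Matrix.mul_assoc]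

/-- The correction term in the right-hand factor starts with `S`, so the left-hand `Π W` kills it.
This form makes `W_M` a congruence of `W`, whence its positivity. -/
theorem obliqueProj_mul_mul_transpose (hW : W.IsSymm) (hG : (Sᵀ * W * S).PosDef) :
    obliqueProj W S * W * (obliqueProj W S)ᵀ = posteriorFactor W S := by
  rw [transpose_obliqueProj hW, Matrix.mul_sub, Matrix.mul_one,
    ← posteriorFactor_eq_obliqueProj_mul]
  have h : posteriorFactor W S * (S * (Sᵀ * W * S)⁻¹ * Sᵀ * W)
      = obliqueProj W S * (W * S) * ((Sᵀ * W * S)⁻¹ * Sᵀ * W) := by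
    rw [posteriorFactor_eq_obliqueProj_mul]; simp only [Matrix.mul_assoc]
  rw [h, obliqueProj_mul_mul hG, Matrix.zero_mul, sub_zero]

theorem isSymm_posteriorFactor (hW : W.IsSymm) : (posteriorFactor W S).IsSymm := by
  simp [Matrix.IsSymm, posteriorFactor, Matrix.transpose_nonsing_inv, hW.eq, Matrix.mul_assoc]

/-- A symmetric perturbation of the prior mean splits into what its observation determines and a
remainder that is not observed. -/
theorem posteriorMean_add_mul {B₀ b : Matrix (Fin N) (Fin N) ℝ} (hW : W.IsSymm) (hb : b.IsSymm) :
    posteriorMean B₀ W S ((B₀ + b) * S) + obliqueProj W S * b * (obliqueProj W S)ᵀ = B₀ + b := by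
  have hd : (B₀ + b) * S - B₀ * S = b * S := by rw [Matrix.add_mul, add_sub_cancel_left]
  rw [transpose_obliqueProj hW, obliqueProj, posteriorMean, hd, Matrix.transpose_mul, hb.eq]
  simp only [Matrix.mul_sub, Matrix.sub_mul, Matrix.mul_one, Matrix.one_mul, Matrix.mul_assoc]
  abel

end Algebra

/-! ### The prior covariance and its square root. -/

section Covariance

open scoped MatrixOrder

theorem symmKron_self_mulVec (W Z : Matrix (Fin N) (Fin N) ℝ) :
    symmKron W W *ᵥ (rowVec Z).ofLp
      = (rowVec ((1 / 2 : ℝ) • (W * Z * Wᵀ + W * Zᵀ * Wᵀ))).ofLp := by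
  ext ⟨i, j⟩
  simp only [Matrix.mulVec, dotProduct, Fintype.sum_prod_type, symmKron_self_apply, rowVec,
    Matrix.smul_apply, Matrix.add_apply, Matrix.mul_apply, Matrix.transpose_apply, smul_eq_mul,
    Finset.sum_mul, ← Finset.sum_add_distrib, Finset.mul_sum]
  rw [Finset.sum_comm]
  -- Both sides agree termwise only after averaging over the exchange of the two summation indices.
  have h : ∀ F : Fin N → Fin N → ℝ, ∑ x, ∑ y, F x y = ∑ x, ∑ y, (F x y + F y x) / 2 := by
    intro F
    have := Finset.sum_comm (s := Finset.univ) (t := Finset.univ) (f := F)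
    simp only [add_div, Finset.sum_add_distrib, ← Finset.sum_div]
    rw [← this]; ring
  rw [h]
  conv_rhs => rw [h]
  refine Finset.sum_congr rfl fun k _ => Finset.sum_congr rfl fun l _ => ?_
  ring

/-- The symmetric square root of the prior covariance, as a map on vectorized matrices. -/
noncomputable def priorRoot (W : Matrix (Fin N) (Fin N) ℝ) :
    EuclideanSpace ℝ (Fin N × Fin N) →L[ℝ] EuclideanSpace ℝ (Fin N × Fin N) :=
  Matrix.toEuclideanCLM (𝕜 := ℝ) (CFC.sqrt (symmKron W W))

variable {W : Matrix (Fin N) (Fin N) ℝ}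

theorem posSemidef_sqrt_symmKron (W : Matrix (Fin N) (Fin N) ℝ) :
    (CFC.sqrt (symmKron W W)).PosSemidef :=
  Matrix.nonneg_iff_posSemidef.1 (CFC.sqrt_nonneg _)

theorem sqrt_symmKron_mul_self (hW : W.PosSemidef) :
    CFC.sqrt (symmKron W W) * CFC.sqrt (symmKron W W) = symmKron W W :=
  CFC.sqrt_mul_sqrt_self _ (posSemidef_symmKron_self hW).nonneg

theorem inner_priorRoot_left (W : Matrix (Fin N) (Fin N) ℝ)
    (x y : EuclideanSpace ℝ (Fin N × Fin N)) : ⟪priorRoot W x, y⟫ = ⟪x, priorRoot W y⟫ :=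
  (Matrix.isPositive_toEuclideanLin_iff.2 (posSemidef_sqrt_symmKron W)).1 x y

theorem priorRoot_priorRoot (hW : W.PosSemidef) (Z : Matrix (Fin N) (Fin N) ℝ) :
    priorRoot W (priorRoot W (rowVec Z))
      = rowVec ((1 / 2 : ℝ) • (W * Z * Wᵀ + W * Zᵀ * Wᵀ)) := by
  apply WithLp.ofLp_injective 2
  rw [← symmKron_self_mulVec, ← sqrt_symmKron_mul_self hW, ← Matrix.mulVec_mulVec]
  rfl

/-- The covariance annihilates antisymmetric matrices, hence so does its self-adjoint root, and the
range of the root is orthogonal to them. The test vector `x` below is an elementary antisymmetric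
matrix. -/
theorem isSymm_unvec_priorRoot (hW : W.PosSemidef) (v : EuclideanSpace ℝ (Fin N × Fin N)) :
    (unvec (priorRoot W v)).IsSymm := by
  ext i j
  set x : EuclideanSpace ℝ (Fin N × Fin N) :=
    EuclideanSpace.single (j, i) 1 - EuclideanSpace.single (i, j) 1 with hx
  have h0 : priorRoot W (priorRoot W x) = 0 := by
    have : x = rowVec (unvec x) := rfl
    rw [this, priorRoot_priorRoot hW]
    have hxt : (unvec x)ᵀ = - unvec x := by
      ext k l
      simp [unvec, hx, Prod.ext_iff, and_comm]
    rw [hxt]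
    simp
    rfl
  have h1 : priorRoot W x = 0 := by
    have h := inner_priorRoot_left W x (priorRoot W x)
    rw [h0, inner_zero_right] at h
    exact inner_self_eq_zero.1 h
  have h2 := inner_priorRoot_left W x v
  rw [h1, inner_zero_left, hx, inner_sub_left, EuclideanSpace.inner_single_left,
    EuclideanSpace.inner_single_left] at h2
  simp only [map_one, one_mul] at h2
  exact sub_eq_zero.1 h2.symm

end Covariance

/-! ### Two-sided multiplication as a linear map. -/

section LinearMaps

theorem inner_rowVec (A B : Matrix (Fin N) (Fin M) ℝ) : ⟪rowVec A, rowVec B⟫ = (Aᵀ * B).trace := by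
  simp only [PiLp.inner_apply, rowVec, Fintype.sum_prod_type, Matrix.trace, Matrix.diag,
    Matrix.mul_apply, Matrix.transpose_apply]
  rw [Finset.sum_comm]
  simp [mul_comm]

/-- The map `B ↦ P B Q` on vectorized matrices. -/
noncomputable def mulMulCLM {N' M' : ℕ} (P : Matrix (Fin N') (Fin N) ℝ)
    (Q : Matrix (Fin M) (Fin M') ℝ) :
    EuclideanSpace ℝ (Fin N × Fin M) →L[ℝ] EuclideanSpace ℝ (Fin N' × Fin M') :=
  LinearMap.toContinuousLinearMap
    { toFun := fun b => rowVec (P * unvec b * Q)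
      map_add' := fun a b => by
        have h : unvec (a + b) = unvec a + unvec b := rfl
        rw [h, Matrix.mul_add, Matrix.add_mul]; rfl
      map_smul' := fun c a => by
        have h : unvec (c • a) = c • unvec a := rfl
        rw [h, Matrix.mul_smul, Matrix.smul_mul]; rfl }

variable {N' M' : ℕ}

theorem mulMulCLM_apply (P : Matrix (Fin N') (Fin N) ℝ) (Q : Matrix (Fin M) (Fin M') ℝ)
    (b : EuclideanSpace ℝ (Fin N × Fin M)) : mulMulCLM P Q b = rowVec (P * unvec b * Q) := rfl

theorem adjoint_mulMulCLM (P : Matrix (Fin N') (Fin N) ℝ) (Q : Matrix (Fin M) (Fin M') ℝ) :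
    (mulMulCLM P Q).adjoint = mulMulCLM Pᵀ Qᵀ := by
  symm
  rw [ContinuousLinearMap.eq_adjoint_iff]
  intro x y
  conv_lhs => rw [mulMulCLM_apply, ← rowVec_unvec y, inner_rowVec]
  conv_rhs => rw [mulMulCLM_apply, ← rowVec_unvec x, inner_rowVec]
  simp only [Matrix.transpose_mul, Matrix.transpose_transpose]
  rw [← Matrix.mul_assoc (unvec x)ᵀ, Matrix.trace_mul_comm _ Q]
  simp only [Matrix.mul_assoc]

theorem observe_eq_mulMulCLM (S : Matrix (Fin N) (Fin M) ℝ) :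
    observe S = mulMulCLM (1 : Matrix (Fin N) (Fin N) ℝ) S := by
  ext1 b
  rw [mulMulCLM_apply, Matrix.one_mul]; rfl

theorem measurable_rowVec_posteriorMean (B₀ W : Matrix (Fin N) (Fin N) ℝ)
    (S : Matrix (Fin N) (Fin M) ℝ) :
    Measurable fun y : EuclideanSpace ℝ (Fin N × Fin M) => rowVec (posteriorMean B₀ W S (unvec y)) := by
  have h1 : Continuous fun y : EuclideanSpace ℝ (Fin N × Fin M) => unvec y :=
    continuous_matrix fun i j => by simp only [unvec, Matrix.of_apply]; fun_prop
  have h2 : Continuous fun y : EuclideanSpace ℝ (Fin N × Fin M) =>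
      posteriorMean B₀ W S (unvec y) := by
    unfold posteriorMean; fun_prop
  refine Continuous.measurable ?_
  exact (PiLp.continuous_toLp 2 _).comp (continuous_pi fun p => h2.matrix_elem p.1 p.2)

end LinearMaps

theorem integral_bayesPosterior {E : Type*} [MeasurableSpace E] (π : Measure E) {ℓ : E → ℝ}
    (hℓ : Measurable ℓ) (hℓ0 : ∀ v, 0 ≤ ℓ v) (f : E → ℝ) :
    ∫ v, f v ∂(bayesPosterior π ℓ) = (∫ v, ℓ v * f v ∂π) / ∫ v, ℓ v ∂π := by
  rw [bayesPosterior, integral_smul_measure,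
    integral_withDensity_eq_integral_toReal_smul (by fun_prop) (by simp),
    integral_eq_lintegral_of_nonneg_ae (ae_of_all _ hℓ0) hℓ.aestronglyMeasurable,
    ENNReal.toReal_inv, div_eq_inv_mul, smul_eq_mul]
  simp only [ENNReal.toReal_ofReal (hℓ0 _), smul_eq_mul]

/-- The affine image of a standard Gaussian vector is the Gaussian with covariance `D D†`. -/
theorem stdGaussian_map_eq_multivariateGaussian {n : Type*} [Fintype n] [DecidableEq n]
    (μ : EuclideanSpace ℝ n) (D : EuclideanSpace ℝ n →L[ℝ] EuclideanSpace ℝ n)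
    {V : Matrix n n ℝ} (hV : V.PosSemidef)
    (h : ∀ t : EuclideanSpace ℝ n, D (D.adjoint t) = WithLp.toLp 2 (V *ᵥ t.ofLp)) :
    (stdGaussian (EuclideanSpace ℝ n)).map (fun v => μ + D v) = multivariateGaussian μ V := by
  have : IsProbabilityMeasure ((stdGaussian (EuclideanSpace ℝ n)).map fun v => μ + D v) :=
    Measure.isProbabilityMeasure_map (by fun_prop)
  apply Measure.ext_of_charFun
  ext t
  rw [charFun_multivariateGaussian hV, charFun_apply, integral_map (by fun_prop) (by fun_prop)]
  have h1 : ∀ v, Complex.exp (⟪μ + D v, t⟫ * Complex.I)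
      = Complex.exp (⟪t, μ⟫ * Complex.I) * Complex.exp (⟪v, D.adjoint t⟫ * Complex.I) := by
    intro v
    rw [inner_add_left, ContinuousLinearMap.adjoint_inner_right, ← Complex.exp_add,
      real_inner_comm]
    congr 1; push_cast; ring
  simp_rw [h1]
  rw [integral_const_mul, ← charFun_apply, charFun_stdGaussian, ← Complex.exp_add]
  have h2 : ‖D.adjoint t‖ ^ 2 = t.ofLp ⬝ᵥ (V *ᵥ t.ofLp) := by
    rw [← real_inner_self_eq_norm_sq, ContinuousLinearMap.adjoint_inner_left, h,
      ← Matrix.toEuclideanCLM_toLp, Matrix.inner_toEuclideanCLM]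
  rw [← h2]
  congr 1; push_cast; ring

/-! ### Splitting the prior draw, and both forms of the posterior. -/

section Posterior

/-- The observed part `v ↦ (L v) S` of a prior draw. -/
noncomputable def observedPart (W : Matrix (Fin N) (Fin N) ℝ) (S : Matrix (Fin N) (Fin M) ℝ) :
    EuclideanSpace ℝ (Fin N × Fin N) →L[ℝ] EuclideanSpace ℝ (Fin N × Fin M) :=
  mulMulCLM (1 : Matrix (Fin N) (Fin N) ℝ) S ∘L priorRoot W

/-- The part of a prior draw that is independent of its observation. -/
noncomputable def residualPart (W : Matrix (Fin N) (Fin N) ℝ) (S : Matrix (Fin N) (Fin M) ℝ) :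
    EuclideanSpace ℝ (Fin N × Fin N) →L[ℝ] EuclideanSpace ℝ (Fin N × Fin N) :=
  mulMulCLM (obliqueProj W S) (obliqueProj W S)ᵀ ∘L priorRoot W

variable {W : Matrix (Fin N) (Fin N) ℝ} {S : Matrix (Fin N) (Fin M) ℝ}

theorem adjoint_priorRoot : (priorRoot W).adjoint = priorRoot W := by
  symm
  rw [ContinuousLinearMap.eq_adjoint_iff]
  exact inner_priorRoot_left W

theorem isSymm_of_posDef (hW : W.PosDef) : W.IsSymm := by
  have := hW.isHermitian.eq
  rwa [Matrix.conjTranspose_eq_transpose_of_trivial] at this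

/-- This is the vanishing cross-covariance. Symmetrization produces two terms: one contains `Π W S`,
the other its transpose `Sᵀ W Πᵀ`. -/
theorem residualPart_adjoint_observedPart (hW : W.PosDef) (hG : (Sᵀ * W * S).PosDef)
    (y : EuclideanSpace ℝ (Fin N × Fin M)) :
    residualPart W S ((observedPart W S).adjoint y) = 0 := by
  have hs := isSymm_of_posDef hW
  have h1 := obliqueProj_mul_mul hG
  have h2 := transpose_mul_mul_obliqueProj_transpose hs hG
  rw [observedPart, ContinuousLinearMap.adjoint_comp, adjoint_priorRoot, adjoint_mulMulCLM,
    residualPart]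
  simp only [ContinuousLinearMap.comp_apply]
  rw [mulMulCLM_apply 1ᵀ, priorRoot_priorRoot hW.posSemidef, mulMulCLM_apply, unvec_rowVec]
  have h3 : ∀ Z : Matrix (Fin N) (Fin M) ℝ,
      obliqueProj W S * (W * (Z * Sᵀ) * W) * (obliqueProj W S)ᵀ
        = obliqueProj W S * W * Z * (Sᵀ * (W * (obliqueProj W S)ᵀ)) := fun Z => by
    simp only [Matrix.mul_assoc]
  have h4 : ∀ Z : Matrix (Fin M) (Fin N) ℝ,
      obliqueProj W S * (W * (S * Z) * W) * (obliqueProj W S)ᵀ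
        = obliqueProj W S * (W * S) * (Z * W * (obliqueProj W S)ᵀ) := fun Z => by
    simp only [Matrix.mul_assoc]
  rw [Matrix.mul_smul, Matrix.smul_mul, Matrix.mul_add, Matrix.add_mul, hs.eq,
    Matrix.transpose_mul, Matrix.transpose_transpose, h3, h4, h1, h2]
  simp
  rfl

theorem residualPart_adjoint_self (hW : W.PosDef) (hG : (Sᵀ * W * S).PosDef)
    (t : EuclideanSpace ℝ (Fin N × Fin N)) :
    residualPart W S ((residualPart W S).adjoint t)
      = WithLp.toLp 2 (symmKron (posteriorFactor W S) (posteriorFactor W S) *ᵥ t.ofLp) := by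
  have hs := isSymm_of_posDef hW
  rw [residualPart, ContinuousLinearMap.adjoint_comp, adjoint_priorRoot, adjoint_mulMulCLM]
  simp only [ContinuousLinearMap.comp_apply]
  rw [mulMulCLM_apply (obliqueProj W S)ᵀ, priorRoot_priorRoot hW.posSemidef, mulMulCLM_apply,
    unvec_rowVec]
  conv_rhs => rw [← rowVec_unvec t, symmKron_self_mulVec]
  have h3 : ∀ Z : Matrix (Fin N) (Fin N) ℝ,
      obliqueProj W S * (W * ((obliqueProj W S)ᵀ * Z * obliqueProj W S) * W) * (obliqueProj W S)ᵀ
        = posteriorFactor W S * Z * posteriorFactor W S := fun Z => by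
    conv_rhs => rw [← obliqueProj_mul_mul_transpose hs hG]
    simp only [Matrix.mul_assoc]
  rw [Matrix.mul_smul, Matrix.smul_mul, Matrix.mul_add, Matrix.add_mul, hs.eq,
    Matrix.transpose_transpose, Matrix.transpose_mul, Matrix.transpose_mul,
    Matrix.transpose_transpose, ← Matrix.mul_assoc (obliqueProj W S)ᵀ, h3, h3,
    (isSymm_posteriorFactor hs).eq]

theorem stdGaussian_map_residualPart (hW : W.PosDef) (hG : (Sᵀ * W * S).PosDef)
    (hV : (symmKron (posteriorFactor W S) (posteriorFactor W S)).PosSemidef)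
    (B : Matrix (Fin N) (Fin N) ℝ) :
    (stdGaussian (EuclideanSpace ℝ (Fin N × Fin N))).map (fun v => rowVec B + residualPart W S v)
      = gaussianBelief B (symmKron (posteriorFactor W S) (posteriorFactor W S)) :=
  stdGaussian_map_eq_multivariateGaussian _ _ hV (residualPart_adjoint_self hW hG)

theorem observe_prior_draw (B₀ : Matrix (Fin N) (Fin N) ℝ)
    (v : EuclideanSpace ℝ (Fin N × Fin N)) :
    observe S (rowVec B₀ + priorRoot W v) = observe S (rowVec B₀) + observedPart W S v := by
  rw [observe_eq_mulMulCLM, map_add]; rfl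

theorem prior_draw_eq (hW : W.PosDef) (B₀ : Matrix (Fin N) (Fin N) ℝ)
    (v : EuclideanSpace ℝ (Fin N × Fin N)) :
    rowVec B₀ + priorRoot W v
      = rowVec (posteriorMean B₀ W S (unvec (observe S (rowVec B₀ + priorRoot W v))))
        + residualPart W S v := by
  have h := posteriorMean_add_mul (S := S) (B₀ := B₀) (isSymm_of_posDef hW)
    (isSymm_unvec_priorRoot hW.posSemidef v)
  exact (congrArg rowVec h).symm

theorem gaussianBelief_eq_map_priorRoot (B₀ : Matrix (Fin N) (Fin N) ℝ) :
    gaussianBelief B₀ (symmKron W W) = (stdGaussian (EuclideanSpace ℝ (Fin N × Fin N))).map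
      fun v => rowVec B₀ + priorRoot W v := rfl

theorem posterior_exactLikelihood_ae_eq (hW : W.PosDef) (hG : (Sᵀ * W * S).PosDef)
    (hV : (symmKron (posteriorFactor W S) (posteriorFactor W S)).PosSemidef)
    (B₀ : Matrix (Fin N) (Fin N) ℝ) :
    ∀ᵐ y ∂((gaussianBelief B₀ (symmKron W W)).map (observe S)),
      posterior (exactLikelihood S) (gaussianBelief B₀ (symmKron W W)) y
        = gaussianBelief (posteriorMean B₀ W S (unvec y))
            (symmKron (posteriorFactor W S) (posteriorFactor W S)) := by
  have h := posterior_deterministic_ae_eq (fun v => rowVec B₀ + priorRoot W v) (by fun_prop)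
    (observedPart W S) (residualPart W S) (residualPart_adjoint_observedPart hW hG)
    (observe S) (measurable_observe S) (observe S (rowVec B₀))
    (fun y => rowVec (posteriorMean B₀ W S (unvec y))) (measurable_rowVec_posteriorMean B₀ W S)
    (observe_prior_draw B₀) (prior_draw_eq hW B₀)
  filter_upwards [h] with y hy
  rw [← stdGaussian_map_residualPart hW hG hV, ← hy]
  rfl

/-- Every symmetric deviation from the prior mean is attained by the prior, so data `B S` with `B`
symmetric lie in the affine range of the observation. The squared root acts on symmetric `Z` as `Z ↦
W Z W`, which dictates the witness. -/
theorem exists_priorRoot_eq (hW : W.PosDef) {b : Matrix (Fin N) (Fin N) ℝ} (hb : b.IsSymm) :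
    ∃ z, priorRoot W z = rowVec b := by
  have hs := isSymm_of_posDef hW
  have hu : IsUnit W.det := hW.det_pos.ne'.isUnit
  refine ⟨priorRoot W (rowVec (W⁻¹ * b * W⁻¹)), ?_⟩
  rw [priorRoot_priorRoot hW.posSemidef]
  have h1 : (W⁻¹ * b * W⁻¹)ᵀ = W⁻¹ * b * W⁻¹ := by
    simp [Matrix.transpose_nonsing_inv, hs.eq, hb.eq, Matrix.mul_assoc]
  have h2 : W * (W⁻¹ * b * W⁻¹) * W = b := by
    rw [Matrix.mul_assoc, Matrix.mul_assoc, Matrix.mul_assoc, Matrix.nonsing_inv_mul _ hu,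
      Matrix.mul_one, Matrix.mul_nonsing_inv_cancel_left _ _ hu]
  rw [h1, hs.eq, h2, ← two_smul ℝ b, smul_smul]
  norm_num

theorem tendsto_integral_bayesPosterior (hW : W.PosDef) (hG : (Sᵀ * W * S).PosDef)
    (hV : (symmKron (posteriorFactor W S) (posteriorFactor W S)).PosSemidef)
    {B₀ B : Matrix (Fin N) (Fin N) ℝ} (hB₀ : B₀.IsSymm) (hB : B.IsSymm)
    (f : BoundedContinuousFunction (EuclideanSpace ℝ (Fin N × Fin N)) ℝ) :
    Tendsto
      (fun Λ : Matrix (Fin N × Fin M) (Fin N × Fin M) ℝ =>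
        ∫ b, f b ∂(bayesPosterior (gaussianBelief B₀ (symmKron W W))
          fun b => gaussianDensity (rowVec (B * S)) (observe S b) Λ))
      (𝓝[{Λ | Λ.PosDef}] 0)
      (𝓝 (∫ b, f b ∂(gaussianBelief (posteriorMean B₀ W S (B * S))
        (symmKron (posteriorFactor W S) (posteriorFactor W S))))) := by
  set A := observedPart W S with hA
  set D := residualPart W S with hD
  have hDA := residualPart_adjoint_observedPart hW hG
  obtain ⟨z₀, hz₀⟩ := exists_priorRoot_eq hW (hB.sub hB₀)
  set P : EuclideanSpace ℝ (Fin N × Fin N) → EuclideanSpace ℝ (Fin N × Fin N) :=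
    fun v => A.ker.starProjection v with hP
  have hAP : ∀ v, A (P v) = 0 := fun v => A.ker.starProjection_apply_mem v
  have hPx : ∀ v, ∃ x, v = P v + A.adjoint x := by
    intro v
    -- In finite dimension the orthogonal complement of `ker A` is the range of `A†`.
    have h : v - P v ∈ A.kerᗮ := A.ker.sub_starProjection_mem_orthogonal v
    rw [ContinuousLinearMap.orthogonal_ker,
      (Submodule.closed_of_finiteDimensional _).submodule_topologicalClosure_eq] at h
    obtain ⟨x, hx⟩ := h
    exact ⟨x, by rw [show A.adjoint x = v - P v from hx]; abel⟩
  have hzB : rowVec B₀ + priorRoot W z₀ = rowVec B := by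
    rw [hz₀]
    exact congrArg rowVec (add_sub_cancel B₀ B)
  have hobsB : observe S (rowVec B₀) + A z₀ = rowVec (B * S) := by
    rw [← observe_prior_draw, hzB]; rfl
  have hDP : ∀ v, D (P v) = D v := by
    intro v
    obtain ⟨x, hx⟩ := hPx v
    conv_rhs => rw [hx, map_add, hDA, add_zero]
  -- The limiting draw has observation exactly `B S` and residual `D v`, because `D` vanishes on the
  -- range of `A†`; the splitting of the prior draw then determines it.
  have hdraw : ∀ v, rowVec B₀ + priorRoot W (z₀ - P z₀ + P v)
      = rowVec (posteriorMean B₀ W S (B * S)) + D v := by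
    intro v
    have h1 : A (z₀ - P z₀ + P v) = A z₀ := by
      rw [map_add, map_sub, hAP, hAP, sub_zero, add_zero]
    have h2 : D (z₀ - P z₀ + P v) = D v := by
      rw [map_add, map_sub, hDP, hDP, sub_self, zero_add]
    rw [prior_draw_eq (S := S) hW, observe_prior_draw, ← hA, ← hD, h1, h2, hobsB, unvec_rowVec]
  have hcont : Continuous fun v => rowVec B₀ + priorRoot W v := by fun_prop
  have hlim := tendsto_integral_exp_div A z₀ P hAP hPx (f.compContinuous ⟨_, hcont⟩)
  simp only [BoundedContinuousFunction.compContinuous_apply, ContinuousMap.coe_mk, hdraw] at hlim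
  rw [← stdGaussian_map_residualPart hW hG hV, integral_map (by fun_prop)
    f.continuous.aestronglyMeasurable]
  refine hlim.congr' ?_
  filter_upwards [self_mem_nhdsWithin] with Λ hΛ
  -- The normalization of the likelihood depends on `Λ` alone and cancels in Bayes' quotient.
  set k : ℝ := 1 / ((2 * Real.pi) ^ ((Fintype.card (Fin N × Fin M) : ℝ) / 2) * √Λ.det) with hk
  have hk0 : 0 < k := by
    have := Real.sqrt_pos.2 hΛ.det_pos
    positivity
  have hobs_cont : Continuous (observe S) := by
    rw [observe_eq_mulMulCLM]; fun_prop
  have hdens : Continuous fun b => gaussianDensity (rowVec (B * S)) (observe S b) Λ := by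
    unfold gaussianDensity; fun_prop
  have hprod : Continuous fun b => gaussianDensity (rowVec (B * S)) (observe S b) Λ * f b :=
    hdens.mul f.continuous
  rw [integral_bayesPosterior _ hdens.measurable
    (fun b => by unfold gaussianDensity; positivity), gaussianBelief_eq_map_priorRoot,
    integral_map (by fun_prop) hprod.aestronglyMeasurable,
    integral_map (by fun_prop) hdens.aestronglyMeasurable]
  have hval : ∀ v, gaussianDensity (rowVec (B * S)) (observe S (rowVec B₀ + priorRoot W v)) Λ
      = k * Real.exp (-(1 / 2 * ((A (v - z₀)).ofLp ⬝ᵥ (Λ⁻¹ *ᵥ (A (v - z₀)).ofLp)))) := by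
    intro v
    have h : rowVec (B * S) - observe S (rowVec B₀ + priorRoot W v) = -A (v - z₀) := by
      rw [observe_prior_draw, ← hobsB, map_sub]; abel
    rw [gaussianDensity, h, WithLp.ofLp_neg, Matrix.mulVec_neg, neg_dotProduct_neg, neg_mul]
  simp_rw [hval, mul_assoc]
  rw [integral_const_mul, integral_const_mul, mul_div_mul_left _ _ hk0.ne']

end Posterior

end MatrixInference

/-- The prior is the Gaussian with mean `B₀` and covariance `W ⊛ W`, and `B S` is observed exactly.
The first two conclusions say that the inverse and the posterior covariance in the formulas are
meaningful. The third says that the posterior under the noise-free (Dirac) likelihood, which is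
unique up to a null set of observations, is the stated Gaussian. The fourth fixes it for every
single observation `Y = B S` of a symmetric matrix `B`: the posterior under Gaussian
noise of covariance `Λ` converges weakly to the same Gaussian as `Λ → 0`. -/
theorem theorem2p3 (N M : ℕ) (B₀ W : Matrix (Fin N) (Fin N) ℝ) (S : Matrix (Fin N) (Fin M) ℝ)
    (hB₀ : B₀.IsSymm) (hW : W.PosDef) (hS : S.rank = M) :
    (Sᵀ * W * S).PosDef ∧
    (symmKron (posteriorFactor W S) (posteriorFactor W S)).PosSemidef ∧
    (∀ᵐ y ∂((gaussianBelief B₀ (symmKron W W)).map (observe S)),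
      posterior (exactLikelihood S) (gaussianBelief B₀ (symmKron W W)) y
        = gaussianBelief (posteriorMean B₀ W S (unvec y))
            (symmKron (posteriorFactor W S) (posteriorFactor W S))) ∧
    ∀ Y : Matrix (Fin N) (Fin M) ℝ,
      (∃ B : Matrix (Fin N) (Fin N) ℝ, B.IsSymm ∧ B * S = Y) →
      ∀ f : BoundedContinuousFunction (EuclideanSpace ℝ (Fin N × Fin N)) ℝ,
        Tendsto
          (fun Λ : Matrix (Fin N × Fin M) (Fin N × Fin M) ℝ =>
            ∫ b, f b ∂(bayesPosterior (gaussianBelief B₀ (symmKron W W))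
              fun b => gaussianDensity (rowVec Y) (observe S b) Λ))
          (𝓝[{Λ | Λ.PosDef}] 0)
          (𝓝 (∫ b, f b ∂(gaussianBelief (posteriorMean B₀ W S Y)
            (symmKron (posteriorFactor W S) (posteriorFactor W S))))) := by
  have hG := posDef_gram hW hS
  have hV : (symmKron (posteriorFactor W S) (posteriorFactor W S)).PosSemidef := by
    have h := hW.posSemidef.mul_mul_conjTranspose_same (obliqueProj W S)
    rw [Matrix.conjTranspose_eq_transpose_of_trivial,
      obliqueProj_mul_mul_transpose (isSymm_of_posDef hW) hG] at h
    exact posSemidef_symmKron_self h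
  refine ⟨hG, hV, posterior_exactLikelihood_ae_eq hW hG hV B₀, ?_⟩
  rintro Y ⟨B, hB, rfl⟩ f
  exact tendsto_integral_bayesPosterior hW hG hV hB₀ hB f
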